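/- Let $m\in\mathbb{N}$ and let $M$ be a connected (Hausdorff) $m$-dimensional $C^\infty$ Riemannian manifold, with Riemannian distance $d$ (the infimum of the lengths of curves joining two points; it induces the topology of $M$). Let $\varphi=(\varphi(x),\,x\in M)$ be a real-valued Gaussian random field (not necessarily centered) on a probability space $(\Omega,\mathcal A,P)$, that is, all its finite-dimensional distributions are (possibly degenerate) Gaussian, and let $\sigma(x,y)^2=\mathbb{E}\bigl((\varphi(x)-\varphi(y))^2\bigr)$ be its variogram. Suppose that there exist $\rho\in(0,1]$, $\eta\in(0,1)$ and $C>0$ such that $$\sigma(x,y)^2\le C\,d(x,y)^{\eta}\qquad\text{for all } x,y\in M \text{ with } d(x,y)<\rho .$$ Then $\varphi$ has a modification $\psi$ (a random field $\psi$ on $(\Omega,\mathcal A,P)$ with $P(\psi(x)=\varphi(x))=1$ for every $x\in M$) which is locally Hölder continuous of order $\gamma$ for all $\gamma\in(0,\eta/2)$ simultaneously. Here, $\psi$ is called locally Hölder continuous of order $\gamma$ if every point of $M$ has a neighbourhood $U$ and a constant $\alpha$, not depending on $\omega$, such that for every $\omega\in\Omega$ and every $z\in U$ there is a neighbourhood $V(\omega)$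 of $z$ with $$|\psi(x,\omega)-\psi(y,\omega)|\le \alpha\, d(x,y)^{\gamma}\qquad\text{for all } x,y\in V(\omega).$$ -/

import Mathlib

open MeasureTheory ProbabilityTheory Topology
open scoped Bundle Manifold

/-- The variogram `σ(x, y)² = E((φ(x) - φ(y))²)` of a random field `φ` indexed by `M`. -/
noncomputable def variogram {M Ω : Type*} [MeasurableSpace Ω] (P : Measure Ω)
    (φ : M → Ω → ℝ) (x y : M) : ℝ :=
  ∫ ω, (φ x ω - φ y ω) ^ 2 ∂P

/-- `ψ` is a modification of `φ`: a random field on the same probability space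
with `P(ψ(x) = φ(x)) = 1` for every index `x`. -/
def IsModificationOf {M Ω : Type*} [MeasurableSpace Ω] (P : Measure Ω)
    (ψ φ : M → Ω → ℝ) : Prop :=
  (∀ x, Measurable (ψ x)) ∧ ∀ x, ∀ᵐ ω ∂P, ψ x ω = φ x ω

/-- All sample paths of `ψ` are locally Hölder continuous of order `γ`, where the neighbourhood `V`
may depend on `ω`, while the Hölder constant `α` does not depend on `ω` and is locally
uniform: the sets `U` cover `M`, and on each of them one constant `α` serves all points. -/
def IsLocallyHolderField {M Ω : Type*} [MetricSpace M] (γ : ℝ) (ψ : M → Ω → ℝ) : Prop :=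
  ∀ x₀ : M, ∃ U ∈ 𝓝 x₀, ∃ α : ℝ, ∀ ω : Ω, ∀ z ∈ U, ∃ V ∈ 𝓝 z, ∀ x ∈ V, ∀ y ∈ V,
    |ψ x ω - ψ y ω| ≤ α * dist x y ^ γ

open scoped ContDiff

/-! This is Kolmogorov–Chentsov chaining. A Gaussian increment has its `p`-th moment bounded by a
multiple of the `p`-th power of its root second moment, whatever its mean, so the variogram bound
gives `E|φ(x) - φ(y)|^p ≤ c d(x,y)^(pη/2)` at short range, for every `p`.

Inverse charts are locally Lipschitz for the Riemannian distance, so dyadic nets of a Euclidean ball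
transfer to `M` with at most `K^n` points at scale `2^(-n)` (`exists_refining_nets`). For `γ < η/2`,
a large `p` beats the number of pairs of net points. Hence almost surely the increments over close
pairs at level `n` are `O(2^(-γn))`, and `exists_abs_sub_le_of_refining_nets` turns this into a
Hölder bound on the union of the nets.

Continuity in `L¹` carries the bound to a countable dense set `D`, which exists because `M` is
connected. The modification is the limit of `φ` along sequences in `D`, and zero off an event of
full measure. The random Hölder constants are absorbed by lowering the exponent slightly on a small
random neighbourhood, so `α = 1` always works. -/

/-! ### Lipschitz bounds for inverse charts. -/

section ChartLipschitz

open Manifold Set Metric Bundle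
open scoped NNReal ENNReal

variable {E : Type*} [NormedAddCommGroup E] [NormedSpace ℝ E]
  {H : Type*} [TopologicalSpace H] {I : ModelWithCorners ℝ E H}
  {M : Type*} [TopologicalSpace M] [ChartedSpace H M]
  [Bundle.RiemannianBundle (fun (x : M) ↦ TangentSpace I x)]
  [IsManifold I 1 M]
  [IsContinuousRiemannianBundle E (fun (x : M) ↦ TangentSpace I x)]

attribute [local instance] normedAddCommGroupTangentSpaceVectorSpace
attribute [local instance] normedSpaceTangentSpaceVectorSpace

/-- The derivative of the inverse of an extended chart is bounded near the image of the base
point. -/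
lemma exists_enorm_mfderivWithin_symm_extChartAt_apply_le (x : M) :
    ∃ C : ℝ≥0, 0 < C ∧ ∀ᶠ y in 𝓝[range I] (extChartAt I x x),
    ∀ w : E, ‖(mfderiv[range I] (extChartAt I x).symm y :
      E →L[ℝ] TangentSpace I ((extChartAt I x).symm y)) w‖ₑ ≤ C * ‖w‖ₑ := by
  rcases eventually_enorm_mfderivWithin_symm_extChartAt_lt I x with ⟨C, C_pos, hC⟩
  refine ⟨C, C_pos, ?_⟩
  refine Filter.Eventually.mono hC fun y hy w ↦ ?_
  refine (ContinuousLinearMap.le_opENorm (mfderiv[range I] (extChartAt I x).symm y :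
    E →L[ℝ] TangentSpace I ((extChartAt I x).symm y)) w).trans ?_
  exact mul_le_mul_left hy.le _

/-- The inverse of an extended chart is Lipschitz near the image of the base point, for the
Riemannian distance. -/
lemma exists_riemannianEDist_extChartAt_symm_le (x : M) :
    ∃ C > (0 : ℝ≥0), ∃ r > (0 : ℝ),
      ∀ u ∈ ball (extChartAt I x x) r ∩ range I, ∀ v ∈ ball (extChartAt I x x) r ∩ range I,
        riemannianEDist I ((extChartAt I x).symm u) ((extChartAt I x).symm v) ≤ C * edist u v := by
  obtain ⟨C, C_pos, hC⟩ := exists_enorm_mfderivWithin_symm_extChartAt_apply_le (I := I) x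
  obtain ⟨r, r_pos, hr⟩ : ∃ r > 0,
      ball (extChartAt I x x) r ∩ range I ⊆ (extChartAt I x).target ∩
        {y | ∀ w : E, ‖(mfderiv[range I] (extChartAt I x).symm y :
          E →L[ℝ] TangentSpace I ((extChartAt I x).symm y)) w‖ₑ ≤ C * ‖w‖ₑ} :=
    mem_nhdsWithin_iff.1 (Filter.inter_mem (extChartAt_target_mem_nhdsWithin x) hC)
  refine ⟨C, C_pos, r, r_pos, fun u hu v hv ↦ ?_⟩
  -- The competing curve is the image of the straight segment, which by convexity stays where the
  -- derivative is bounded by `C`.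
  let η := ContinuousAffineMap.lineMap (R := ℝ) u v
  set γ := (extChartAt I x).symm ∘ η
  have hη : Icc 0 1 ⊆ ⇑η ⁻¹' ((extChartAt I x).target ∩
        {y | ∀ w : E, ‖(mfderiv[range I] (extChartAt I x).symm y :
          E →L[ℝ] TangentSpace I ((extChartAt I x).symm y)) w‖ₑ ≤ C * ‖w‖ₑ}) := by
    simp only [← image_subset_iff, ContinuousAffineMap.coe_lineMap_eq,
     ← segment_eq_image_lineMap, η]
    exact (((convex_ball _ _).inter I.convex_range).segment_subset hu hv).trans hr
  simp only [preimage_inter, subset_inter_iff] at hη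
  have η_smooth : CMDiff[Icc 0 1] 1 η := by
    apply ContMDiff.contMDiffOn
    rw [contMDiff_iff_contDiff]
    exact ContinuousAffineMap.contDiff _
  have : riemannianEDist I ((extChartAt I x).symm u) ((extChartAt I x).symm v)
      ≤ pathELength I γ 0 1 := by
    apply riemannianEDist_le_pathELength _ _ _ zero_le_one
    · exact (contMDiffOn_extChartAt_symm x).comp η_smooth hη.1
    · simp [γ, η, ContinuousAffineMap.coe_lineMap_eq]
    · simp [γ, η, ContinuousAffineMap.coe_lineMap_eq]
  apply this.trans
  rw [← lintegral_fderiv_lineMap_eq_edist, pathELength_eq_lintegral_mfderivWithin_Icc,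
    ← lintegral_const_mul' _ _ ENNReal.coe_ne_top]
  apply setLIntegral_mono' measurableSet_Icc (fun t ht ↦ ?_)
  have : mfderiv[Icc 0 1] γ t =
      (mfderiv[range I] (extChartAt I x).symm (η t)) ∘L (mfderiv[Icc 0 1] η t) := by
    apply mfderivWithin_comp
    · exact mdifferentiableWithinAt_extChartAt_symm (hη.1 ht)
    · exact η_smooth.mdifferentiableOn one_ne_zero t ht
    · exact hη.1.trans (preimage_mono (extChartAt_target_subset_range x))
    · rw [uniqueMDiffWithinAt_iff_uniqueDiffWithinAt]
      exact uniqueDiffOn_Icc zero_lt_one t ht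
  have : mfderiv[Icc 0 1] γ t 1 =
      (mfderiv[range I] (extChartAt I x).symm (η t)) (mfderiv[Icc 0 1] η t 1) := congr($this 1)
  rw [this]
  refine (hη.2 ht _).trans (le_of_eq ?_)
  simp only [mfderivWithin_eq_fderivWithin]
  rfl

end ChartLipschitz

/-! ### Refining nets. -/

/-- In a proper real normed space there are refining finite nets of the unit ball, of exponential
growth, in which each point is close to a point of the previous net. -/
lemma exists_refining_nets_unitBall (E : Type*) [NormedAddCommGroup E] [NormedSpace ℝ E]
    [ProperSpace E] :
    ∃ (B : ℕ → Finset E) (K : ℕ), Monotone B ∧ (∀ n, (B n).card ≤ K ^ n) ∧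
      (∀ n, ∀ s ∈ B (n + 1), ∃ a ∈ B n, dist s a ≤ 1 / 2 ^ n) ∧
      (∀ n, ∀ s ∈ B n, ‖s‖ < 2) ∧
      ∀ x : E, ‖x‖ ≤ 1 → ∀ n, ∃ a ∈ B n, dist x a ≤ 1 / 2 ^ n := by
  classical
  obtain ⟨F, hF, hFc⟩ : ∃ F : Finset E, (∀ f ∈ F, ‖f‖ ≤ 1) ∧
      ∀ x : E, ‖x‖ ≤ 1 → ∃ f ∈ F, ‖x - f‖ ≤ 1 / 2 := by
    obtain ⟨t, ht, htf, hc⟩ := (isCompact_closedBall (0 : E) 1).finite_cover_balls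
      (show (0 : ℝ) < 1 / 2 by norm_num)
    refine ⟨htf.toFinset, fun f hf ↦ ?_, fun x hx ↦ ?_⟩
    · simpa using ht (by simpa using hf)
    · have := hc (show x ∈ Metric.closedBall (0 : E) 1 by simpa using hx)
      simp only [Set.mem_iUnion, Metric.mem_ball, exists_prop] at this
      obtain ⟨f, hf, hd⟩ := this
      exact ⟨f, by simpa using hf, by rw [← dist_eq_norm]; exact hd.le⟩
  -- The added `0` makes the nets nested.
  let G := insert 0 F
  have hG : ∀ f ∈ G, ‖f‖ ≤ 1 := by
    intro f hf
    rcases Finset.mem_insert.1 hf with rfl | h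
    · simp
    · exact hF f h
  -- `B n` consists of the expansions `∑_{k<n} 2^(-k) f_k` with digits `f_k ∈ G`.
  let B : ℕ → Finset E := fun n ↦ Nat.rec {0}
    (fun n A ↦ Finset.image₂ (fun a f ↦ a + (1 / 2 ^ n : ℝ) • f) A G) n
  have hB0 : B 0 = {0} := rfl
  have hB : ∀ n, B (n + 1) = Finset.image₂ (fun a f ↦ a + (1 / 2 ^ n : ℝ) • f) (B n) G :=
    fun n ↦ rfl
  refine ⟨B, G.card, ?_, ?_, ?_, ?_, ?_⟩
  · refine monotone_nat_of_le_succ fun n s hs ↦ ?_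
    rw [hB]
    exact Finset.mem_image₂.2 ⟨s, hs, 0, Finset.mem_insert_self _ _, by simp⟩
  · intro n
    induction n with
    | zero => simp [hB0]
    | succ n ih =>
      rw [hB, pow_succ]
      exact (Finset.card_image₂_le _ _ _).trans (Nat.mul_le_mul_right _ ih)
  · intro n s hs
    rw [hB] at hs
    obtain ⟨a, ha, f, hf, rfl⟩ := Finset.mem_image₂.1 hs
    refine ⟨a, ha, ?_⟩
    rw [dist_eq_norm, add_sub_cancel_left, norm_smul, Real.norm_of_nonneg (by positivity)]
    exact mul_le_of_le_one_right (by positivity) (hG f hf)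
  · have key : ∀ n, ∀ s ∈ B n, ‖s‖ ≤ 2 - 2 / 2 ^ n := by
      intro n
      induction n with
      | zero => simp [hB0]
      | succ n ih =>
        intro s hs
        rw [hB] at hs
        obtain ⟨a, ha, f, hf, rfl⟩ := Finset.mem_image₂.1 hs
        have h1 : ‖(1 / 2 ^ n : ℝ) • f‖ ≤ 1 / 2 ^ n := by
          rw [norm_smul, Real.norm_of_nonneg (by positivity)]
          exact mul_le_of_le_one_right (by positivity) (hG f hf)
        have h2 : (2 : ℝ) / 2 ^ (n + 1) = 1 / 2 ^ n := by rw [pow_succ]; field_simp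
        have h3 : (2 : ℝ) / 2 ^ n = 2 * (1 / 2 ^ n) := by ring
        have := norm_add_le a ((1 / 2 ^ n : ℝ) • f)
        have := ih a ha
        linarith
    intro n s hs
    have : (0 : ℝ) < 2 / 2 ^ n := by positivity
    linarith [key n s hs]
  · intro x hx n
    induction n with
    | zero => exact ⟨0, by simp [hB0], by simpa using hx⟩
    | succ n ih =>
      obtain ⟨a, ha, hd⟩ := ih
      rw [dist_eq_norm] at hd
      -- The remainder, rescaled by `2^n`, lies in the unit ball; the next digit approximates it to
      -- within `1/2`.
      obtain ⟨f, hf, hfd⟩ := hFc ((2 ^ n : ℝ) • (x - a)) (by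
        rw [norm_smul, Real.norm_of_nonneg (by positivity)]
        calc (2 : ℝ) ^ n * ‖x - a‖ ≤ 2 ^ n * (1 / 2 ^ n) := by gcongr
          _ = 1 := by field_simp)
      refine ⟨a + (1 / 2 ^ n : ℝ) • f, ?_, ?_⟩
      · rw [hB]
        exact Finset.mem_image₂.2 ⟨a, ha, f, Finset.mem_insert_of_mem hf, rfl⟩
      · have : x - (a + (1 / 2 ^ n : ℝ) • f) = (1 / 2 ^ n : ℝ) • ((2 ^ n : ℝ) • (x - a) - f) := by
          rw [smul_sub, smul_smul, one_div, inv_mul_cancel₀ (by positivity), one_smul]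
          abel
        rw [dist_eq_norm, this, norm_smul, Real.norm_of_nonneg (by positivity), pow_succ]
        calc (1 : ℝ) / 2 ^ n * _ ≤ 1 / 2 ^ n * (1 / 2) := by gcongr
          _ = _ := by field_simp

/-- Every point of a Riemannian manifold has a neighbourhood with refining finite nets of
exponential growth, in which each point is close to a point of the previous net. -/
lemma exists_refining_nets {E : Type*} [NormedAddCommGroup E] [NormedSpace ℝ E] [ProperSpace E]
    {M : Type*} [MetricSpace M] [ChartedSpace E M] [IsManifold 𝓘(ℝ, E) 1 M]
    [Bundle.RiemannianBundle (fun (x : M) ↦ TangentSpace 𝓘(ℝ, E) x)]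
    [IsContinuousRiemannianBundle E (fun (x : M) ↦ TangentSpace 𝓘(ℝ, E) x)]
    [IsRiemannianManifold 𝓘(ℝ, E) M] (x₀ : M) {δ : ℝ} (hδ : 0 < δ) :
    ∃ (A : ℕ → Finset M) (K : ℕ) (c : ℝ), 0 < c ∧ c ≤ δ ∧ Monotone A ∧
      (∀ n, (A n).card ≤ K ^ n) ∧
      (∀ n, ∀ s ∈ A (n + 1), ∃ a ∈ A n, dist s a ≤ c / 2 ^ n) ∧
      closure (⋃ n, (A n : Set M)) ∈ 𝓝 x₀ := by
  classical
  obtain ⟨B, K, hmono, hcard, hpar, hnorm, hnet⟩ := exists_refining_nets_unitBall E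
  obtain ⟨L, hL, r₀, hr₀, hlip⟩ := exists_riemannianEDist_extChartAt_symm_le (I := 𝓘(ℝ, E)) x₀
  set e := extChartAt 𝓘(ℝ, E) x₀ with he
  have hLp : (0 : ℝ) < L := by exact_mod_cast hL
  have hlip' : ∀ u ∈ Metric.ball (e x₀) r₀, ∀ v ∈ Metric.ball (e x₀) r₀,
      dist (e.symm u) (e.symm v) ≤ L * dist u v := by
    intro u hu v hv
    have h := hlip u ⟨hu, by simp⟩ v ⟨hv, by simp⟩
    rw [← IsRiemannianManifold.out (I := 𝓘(ℝ, E))] at h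
    rw [dist_edist, dist_edist, ← ENNReal.coe_toReal, ← ENNReal.toReal_mul]
    exact ENNReal.toReal_mono (ENNReal.mul_ne_top ENNReal.coe_ne_top (edist_ne_top _ _)) h
  -- `r₀ / 2` because the nets fill a ball of radius 2; `δ / L` so that the mesh constant `L * r` is
  -- at most `δ`.
  set r := min (r₀ / 2) (δ / L) with hr
  have hrpos : 0 < r := lt_min (by positivity) (by positivity)
  have hr2 : 2 * r ≤ r₀ := by have := min_le_left (r₀ / 2) (δ / L); linarith
  let f : E → M := fun b ↦ e.symm (e x₀ + r • b)
  have hmem : ∀ b : E, ‖b‖ < 2 → e x₀ + r • b ∈ Metric.ball (e x₀) r₀ := by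
    intro b hb
    rw [Metric.mem_ball, dist_eq_norm, add_sub_cancel_left, norm_smul,
      Real.norm_of_nonneg hrpos.le]
    nlinarith
  have hf : ∀ a b : E, ‖a‖ < 2 → ‖b‖ < 2 → dist (f a) (f b) ≤ L * r * dist a b := by
    intro a b ha hb
    refine (hlip' _ (hmem a ha) _ (hmem b hb)).trans ?_
    rw [dist_add_left, dist_smul₀, Real.norm_of_nonneg hrpos.le, mul_assoc]
  refine ⟨fun n ↦ (B n).image f, K, L * r, by positivity, ?_, ?_, ?_, ?_, ?_⟩
  · calc L * r ≤ L * (δ / L) := by gcongr; exact min_le_right _ _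
      _ = δ := by field_simp
  · exact fun i j hij ↦ Finset.image_subset_image (hmono hij)
  · exact fun n ↦ Finset.card_image_le.trans (hcard n)
  · intro n s hs
    obtain ⟨b, hb, rfl⟩ := Finset.mem_image.1 hs
    obtain ⟨a, ha, hd⟩ := hpar n b hb
    refine ⟨f a, Finset.mem_image_of_mem _ ha, (hf b a (hnorm _ _ hb) (hnorm _ _ ha)).trans ?_⟩
    calc L * r * dist b a ≤ L * r * (1 / 2 ^ n) := by gcongr
      _ = _ := by ring
  · have h1 : ∀ᶠ y in 𝓝 x₀, e y ∈ Metric.ball (e x₀) r :=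
      (continuousAt_extChartAt x₀).eventually (Metric.ball_mem_nhds _ hrpos)
    filter_upwards [h1, extChartAt_source_mem_nhds (I := 𝓘(ℝ, E)) x₀] with y hy hys
    obtain ⟨b, hb, hyb⟩ : ∃ b : E, ‖b‖ ≤ 1 ∧ y = f b := by
      refine ⟨r⁻¹ • (e y - e x₀), ?_, ?_⟩
      · rw [Metric.mem_ball, dist_eq_norm] at hy
        rw [norm_smul, norm_inv, Real.norm_of_nonneg hrpos.le, inv_mul_le_iff₀ hrpos]
        linarith
      · simp only [f]
        rw [smul_inv_smul₀ hrpos.ne', add_sub_cancel, e.left_inv hys]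
    rw [Metric.mem_closure_iff]
    intro ε hε
    obtain ⟨n, hn⟩ := exists_pow_lt_of_lt_one (show 0 < ε / (L * r) by positivity)
      (show (1 / 2 : ℝ) < 1 by norm_num)
    obtain ⟨a, ha, hd⟩ := hnet b hb n
    refine ⟨f a, Set.mem_iUnion.2 ⟨n, Finset.mem_coe.2 (Finset.mem_image_of_mem _ ha)⟩, ?_⟩
    rw [hyb]
    refine (hf b a (by linarith) (hnorm _ _ ha)).trans_lt ?_
    calc L * r * dist b a ≤ L * r * (1 / 2) ^ n := by rw [one_div_pow]; gcongr
      _ < L * r * (ε / (L * r)) := by gcongr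
      _ = ε := by field_simp

/-! ### Separability from connectedness. -/

/-- A connected metric space in which every point has a separable neighbourhood is separable. -/
lemma exists_countable_dense_of_connected {M : Type*} [MetricSpace M] [ConnectedSpace M]
    (h : ∀ x : M, ∃ c : Set M, c.Countable ∧ closure c ∈ 𝓝 x) :
    ∃ D : Set M, D.Countable ∧ Dense D := by
  have h' : ∀ x : M, ∃ q : ℚ, 0 < q ∧ ∃ c : Set M, c.Countable ∧ Metric.ball x q ⊆ closure c := by
    intro x
    obtain ⟨c, hc, hx⟩ := h x
    obtain ⟨ε, hε, hb⟩ := Metric.mem_nhds_iff.1 hx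
    obtain ⟨q, hq0, hq⟩ := exists_rat_btwn hε
    exact ⟨q, by exact_mod_cast hq0, c, hc, (Metric.ball_subset_ball hq.le).trans hb⟩
  -- `g x q` is a countable set dense in the ball of radius `q` around `x`, if there is one
  have h2 : ∀ (x : M) (q : ℚ), ∃ c : Set M, c.Countable ∧
      ((∃ c' : Set M, c'.Countable ∧ Metric.ball x q ⊆ closure c') →
        Metric.ball x q ⊆ closure c) := by
    intro x q
    by_cases hx : ∃ c' : Set M, c'.Countable ∧ Metric.ball x q ⊆ closure c'
    · obtain ⟨c', hc', hb⟩ := hx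
      exact ⟨c', hc', fun _ ↦ hb⟩
    · exact ⟨∅, Set.countable_empty, fun h ↦ absurd h hx⟩
  choose g hg hgb using h2
  obtain ⟨x₀⟩ := (inferInstance : Nonempty M)
  -- Saturating `{x₀}` under `g`, with rational radii to stay countable, gives a set whose closure
  -- is open as well as closed.
  let S : ℕ → Set M := fun n ↦ Nat.rec {x₀} (fun n A ↦ ⋃ d ∈ A, ⋃ q : ℚ, g d q) n
  have hS : ∀ n, (S n).Countable := by
    intro n
    induction n with
    | zero => exact Set.countable_singleton x₀
    | succ n ih => exact ih.biUnion fun d _ ↦ Set.countable_iUnion fun q ↦ hg d q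
  let D := ⋃ n, S n
  have hD : D.Countable := Set.countable_iUnion hS
  refine ⟨D, hD, ?_⟩
  have hgD : ∀ d ∈ D, ∀ q, g d q ⊆ D := by
    intro d hd q y hy
    obtain ⟨n, hn⟩ := Set.mem_iUnion.1 hd
    exact Set.mem_iUnion.2 ⟨n + 1, Set.mem_biUnion hn (Set.mem_iUnion.2 ⟨q, hy⟩)⟩
  have hopen : IsOpen (closure D) := by
    rw [Metric.isOpen_iff]
    intro x hx
    obtain ⟨q, hq, c, hc, hb⟩ := h' x
    have hq' : (0 : ℝ) < q := by exact_mod_cast hq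
    obtain ⟨d, hd, hxd⟩ := Metric.mem_closure_iff.1 hx (q / 4) (by positivity)
    have hsub : Metric.ball d ((q / 2 : ℚ) : ℝ) ⊆ Metric.ball x q := by
      apply Metric.ball_subset_ball'
      push_cast
      rw [dist_comm]
      linarith
    refine ⟨q / 4, by positivity, ?_⟩
    have h3 : Metric.ball x (q / 4) ⊆ Metric.ball d ((q / 2 : ℚ) : ℝ) := by
      apply Metric.ball_subset_ball'
      push_cast
      linarith
    exact h3.trans ((hgb d (q / 2) ⟨c, hc, hsub.trans hb⟩).trans (closure_mono (hgD d hd _)))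
  have huniv := IsClopen.eq_univ ⟨isClosed_closure, hopen⟩
    ⟨x₀, subset_closure (Set.mem_iUnion.2 ⟨0, rfl⟩)⟩
  exact dense_iff_closure_eq.2 huniv

/-! ### Gaussian moments and almost sure decay. -/

section Moments

open scoped ENNReal NNReal

/-- The moments of a real Gaussian variable are controlled by its second moment. -/
lemma exists_lintegral_enorm_pow_le_of_hasGaussianLaw (p : ℕ) :
    ∃ c : ℝ≥0∞, c ≠ ⊤ ∧ ∀ {Ω : Type*} [MeasurableSpace Ω] (P : Measure Ω) (X : Ω → ℝ),
      HasGaussianLaw X P →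
      ∫⁻ w, ‖X w‖ₑ ^ p ∂P ≤ c * ENNReal.ofReal (√(∫ w, X w ^ 2 ∂P)) ^ p := by
  -- In law `X = μ + √v N` with `N` standard normal and both `|μ|` and `√v` at most `σ`, so `|X|` is
  -- dominated by `σ (1 + |N|)`.
  refine ⟨∫⁻ x, ENNReal.ofReal ((1 + ‖x‖) ^ p) ∂(gaussianReal 0 1), ?_, ?_⟩
  · have h1 : MemLp (fun x : ℝ ↦ 1 + ‖x‖) p (gaussianReal 0 1) :=
      MemLp.add (f := fun _ ↦ (1 : ℝ)) (g := fun x ↦ ‖x‖) (memLp_const _)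
        (memLp_id_gaussianReal' (p : ℝ≥0∞) (by simp)).norm
    have h2 := h1.integrable_norm_pow'
    refine ne_of_eq_of_ne (lintegral_congr fun x ↦ ?_) h2.lintegral_lt_top.ne
    rw [Real.norm_of_nonneg (by positivity : 0 ≤ 1 + ‖x‖)]
  · intro Ω _ P X hX
    have := hX.isProbabilityMeasure
    set σ := √(∫ w, X w ^ 2 ∂P) with hσ
    set μ := ∫ w, X w ∂P with hμ
    set v := Var[X; P] with hv
    have hvar : v = (∫ w, X w ^ 2 ∂P) - μ ^ 2 := by
      rw [hv, variance_eq_sub hX.memLp_two]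
      rfl
    have hv0 : 0 ≤ v := variance_nonneg _ _
    have hμσ : |μ| ≤ σ := Real.abs_le_sqrt (by linarith)
    have hvσ : √v ≤ σ := Real.sqrt_le_sqrt (by nlinarith [sq_nonneg μ])
    have hσ0 : 0 ≤ σ := Real.sqrt_nonneg _
    have hlaw : P.map X = (gaussianReal 0 1).map (fun x ↦ μ + √v * x) := by
      rw [hX.map_eq_gaussianReal]
      have h1 : (fun x : ℝ ↦ μ + √v * x) = (fun x ↦ μ + x) ∘ (fun x ↦ √v * x) := rfl
      rw [h1, ← Measure.map_map (by fun_prop) (by fun_prop), gaussianReal_map_const_mul,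
        gaussianReal_map_const_add]
      congr 1
      · simp [hμ]
      · ext
        simp [hv]
    have hmap : ∫⁻ w, ‖X w‖ₑ ^ p ∂P = ∫⁻ x, ‖μ + √v * x‖ₑ ^ p ∂(gaussianReal 0 1) := by
      rw [← lintegral_map' (f := fun x : ℝ ↦ ‖x‖ₑ ^ p) (by fun_prop) hX.aemeasurable, hlaw,
        lintegral_map (by fun_prop) (by fun_prop)]
    rw [hmap, ← lintegral_mul_const' _ _ (by finiteness)]
    refine lintegral_mono fun x ↦ ?_
    rw [ENNReal.ofReal_pow (by positivity), ← mul_pow, ← ENNReal.ofReal_mul (by positivity),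
      ← ofReal_norm]
    gcongr
    calc ‖μ + √v * x‖ ≤ ‖μ‖ + ‖√v * x‖ := norm_add_le _ _
      _ = |μ| + √v * ‖x‖ := by rw [norm_mul, Real.norm_of_nonneg (Real.sqrt_nonneg v)]; rfl
      _ ≤ σ + σ * ‖x‖ := by gcongr
      _ = (1 + ‖x‖) * σ := by ring

/-- The moments of the increments of a Gaussian process whose variogram satisfies a local Hölder
bound. -/
lemma IsGaussianProcess.exists_lintegral_enorm_sub_pow_le {M Ω : Type*} [MetricSpace M]
    [MeasurableSpace Ω] {P : Measure Ω} {φ : M → Ω → ℝ} (hφ : IsGaussianProcess φ P)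
    {ρ η C : ℝ} (hC : 0 ≤ C)
    (hvar : ∀ x y : M, dist x y < ρ → variogram P φ x y ≤ C * dist x y ^ η) (p : ℕ) :
    ∃ c : ℝ≥0∞, c ≠ ⊤ ∧ ∀ x y : M, dist x y < ρ →
      ∫⁻ w, ‖φ x w - φ y w‖ₑ ^ p ∂P ≤ c * ENNReal.ofReal (dist x y ^ (η / 2)) ^ p := by
  obtain ⟨c, hc, h⟩ := exists_lintegral_enorm_pow_le_of_hasGaussianLaw p
  refine ⟨c * ENNReal.ofReal (√C) ^ p, by finiteness, fun x y hxy ↦ ?_⟩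
  refine (h P _ (hφ.hasGaussianLaw_fun_sub (s := x) (t := y))).trans ?_
  rw [mul_assoc, ← mul_pow, ← ENNReal.ofReal_mul (Real.sqrt_nonneg _)]
  gcongr
  have h1 : dist x y ^ (η / 2) = √(dist x y ^ η) := by
    rw [Real.sqrt_eq_rpow, ← Real.rpow_mul dist_nonneg]
    ring_nf
  rw [h1, ← Real.sqrt_mul hC]
  exact Real.sqrt_le_sqrt (hvar x y hxy)

/-- If the `p`-th moments of finite families of exponentially growing sizes decay fast enough, then
almost surely the families decay geometrically. -/
lemma ae_exists_forall_abs_le_of_lintegral_le {ι Ω : Type*} [MeasurableSpace Ω] {P : Measure Ω}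
    {Z : ι → Ω → ℝ} (hZ : ∀ i, Measurable (Z i)) (S : ℕ → Finset ι) {k K p : ℕ} (hp : p ≠ 0)
    (hS : ∀ n, (S n).card ≤ k * K ^ n) {B : ℝ≥0∞} (hB : B ≠ ⊤) {θ q : ℝ} (hθ : 0 ≤ θ) (hq : 0 < q)
    (hZp : ∀ n, ∀ i ∈ S n, ∫⁻ w, ‖Z i w‖ₑ ^ p ∂P ≤ B * ENNReal.ofReal (θ ^ n) ^ p)
    (hK : K * (θ / q) ^ p < 1) :
    ∀ᵐ w ∂P, ∃ R : ℝ, ∀ n, ∀ i ∈ S n, |Z i w| ≤ R * q ^ n := by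
  -- The expectation of `F` is dominated by a geometric series, so `F` is almost surely finite and
  -- bounds every normalized term at once.
  let F : Ω → ℝ≥0∞ := fun w ↦ ∑' n, ∑ i ∈ S n, ‖Z i w / q ^ n‖ₑ ^ p
  have hterm : ∀ n, ∀ i ∈ S n, ∫⁻ w, ‖Z i w / q ^ n‖ₑ ^ p ∂P
      ≤ B * ENNReal.ofReal ((θ / q) ^ p) ^ n := by
    intro n i hi
    have h1 : ∀ w, ‖Z i w / q ^ n‖ₑ ^ p
        = ENNReal.ofReal ((q ^ n)⁻¹) ^ p * ‖Z i w‖ₑ ^ p := by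
      intro w
      rw [div_eq_inv_mul, enorm_mul, mul_pow, Real.enorm_of_nonneg (by positivity)]
    simp_rw [h1]
    rw [lintegral_const_mul _ (by fun_prop)]
    calc _ ≤ ENNReal.ofReal ((q ^ n)⁻¹) ^ p * (B * ENNReal.ofReal (θ ^ n) ^ p) := by
          gcongr
          exact hZp n i hi
      _ = B * (ENNReal.ofReal ((q ^ n)⁻¹) * ENNReal.ofReal (θ ^ n)) ^ p := by ring
      _ = _ := by
          rw [← ENNReal.ofReal_mul (by positivity), ← ENNReal.ofReal_pow (by positivity),
            ← ENNReal.ofReal_pow (by positivity)]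
          congr 2
          rw [← div_eq_inv_mul, ← div_pow]
          ring
  have hF : ∫⁻ w, F w ∂P ≠ ⊤ := by
    have hm : ∀ n, Measurable fun w ↦ ∑ i ∈ S n, ‖Z i w / q ^ n‖ₑ ^ p := by
      intro n
      refine Finset.measurable_sum _ fun i _ ↦ ?_
      have := hZ i
      fun_prop
    simp only [F]
    rw [lintegral_tsum fun n ↦ (hm n).aemeasurable]
    have hle : ∀ n, ∫⁻ w, ∑ i ∈ S n, ‖Z i w / q ^ n‖ₑ ^ p ∂P
        ≤ (k * B) * ENNReal.ofReal (K * (θ / q) ^ p) ^ n := by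
      intro n
      rw [lintegral_finsetSum _ fun i _ ↦ by have := hZ i; fun_prop]
      refine (Finset.sum_le_sum (hterm n)).trans ?_
      rw [Finset.sum_const, nsmul_eq_mul, ENNReal.ofReal_mul (by positivity),
        ENNReal.ofReal_natCast, mul_pow]
      calc _ ≤ ((k * K ^ n : ℕ) : ℝ≥0∞) * (B * ENNReal.ofReal ((θ / q) ^ p) ^ n) := by
            gcongr
            exact hS n
        _ = _ := by push_cast; ring
    refine ne_top_of_le_ne_top ?_ (ENNReal.tsum_le_tsum hle)
    rw [ENNReal.tsum_mul_left, ENNReal.tsum_geometric]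
    refine ENNReal.mul_ne_top (by finiteness) (ENNReal.inv_ne_top.2 ?_)
    rw [ne_eq, tsub_eq_zero_iff_le, not_le, ENNReal.ofReal_lt_one]
    exact hK
  have hFm : Measurable F := by
    refine Measurable.tsum fun n ↦ Finset.measurable_sum _ fun i _ ↦ ?_
    have := hZ i
    fun_prop
  filter_upwards [ae_lt_top hFm hF] with w hw
  refine ⟨1 + (F w).toReal, fun n i hi ↦ ?_⟩
  have hqn : 0 < q ^ n := by positivity
  rw [← div_le_iff₀ hqn]
  set y := |Z i w| / q ^ n with hy
  have hy0 : 0 ≤ y := by positivity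
  have hyF : y ^ p ≤ (F w).toReal := by
    have h1 : ‖Z i w / q ^ n‖ₑ ^ p ≤ F w :=
      (Finset.single_le_sum (f := fun i ↦ ‖Z i w / q ^ n‖ₑ ^ p) (fun _ _ ↦ zero_le) hi).trans
        (ENNReal.le_tsum n)
    have h2 := ENNReal.toReal_mono hw.ne h1
    rwa [ENNReal.toReal_pow, toReal_enorm, Real.norm_eq_abs, abs_div, abs_of_pos hqn] at h2
  rcases le_total y 1 with h | h
  · have : 0 ≤ (F w).toReal := ENNReal.toReal_nonneg
    linarith
  · linarith [le_self_pow₀ h hp]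

end Moments

/-! ### Deterministic chaining. -/

/-- Deterministic chaining along refining nets: geometric decay of the increments over
neighbouring points of the nets implies a Hölder bound on the union of the nets. -/
lemma exists_abs_sub_le_of_refining_nets {M : Type*} [MetricSpace M] {A : ℕ → Finset M} {c : ℝ}
    (hc : 0 < c) (hmono : Monotone A)
    (hpar : ∀ n, ∀ s ∈ A (n + 1), ∃ a ∈ A n, dist s a ≤ c / 2 ^ n)
    {γ : ℝ} (hγ : 0 < γ) {f : M → ℝ} {R : ℝ}
    (hf : ∀ n, ∀ a ∈ A (n + 1), ∀ b ∈ A (n + 1), dist a b ≤ 5 * c / 2 ^ n →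
      |f a - f b| ≤ R * ((1 / 2 : ℝ) ^ γ) ^ n) :
    ∃ R' : ℝ, ∀ s ∈ ⋃ n, (A n : Set M), ∀ t ∈ ⋃ n, (A n : Set M), dist s t ≤ c →
      |f s - f t| ≤ R' * dist s t ^ γ := by
  set q : ℝ := (1 / 2 : ℝ) ^ γ with hq
  have hq0 : 0 < q := by positivity
  have hq1 : q < 1 := Real.rpow_lt_one (by norm_num) (by norm_num) hγ
  have h1q : 0 < 1 - q := by linarith
  by_cases hR : 0 ≤ R
  swap
  · refine ⟨0, fun s hs t ht _ ↦ ?_⟩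
    obtain ⟨n, hn⟩ := Set.mem_iUnion.1 hs
    have h1 : s ∈ A (n + 1) := hmono (Nat.le_succ n) hn
    have := hf n s h1 s h1 (by rw [dist_self]; positivity)
    have h2 : R * q ^ n < 0 := mul_neg_of_neg_of_pos (not_le.1 hR) (by positivity)
    linarith [abs_nonneg (f s - f s)]
  -- Following parents down to level `n` gives two geometric sums; keeping their exact partial sums
  -- lets the induction close.
  have anc : ∀ n j, ∀ s ∈ A (n + j), ∃ a ∈ A n, dist s a ≤ 2 * c / 2 ^ n * (1 - 1 / 2 ^ j) ∧
      |f s - f a| ≤ R * q ^ n / (1 - q) * (1 - q ^ j) := by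
    intro n j
    induction j with
    | zero => exact fun s hs ↦ ⟨s, hs, by simp, by simp⟩
    | succ j ih =>
      intro s hs
      obtain ⟨s', hs', hd⟩ := hpar (n + j) s hs
      obtain ⟨a, ha, had, haf⟩ := ih s' hs'
      refine ⟨a, ha, ?_, ?_⟩
      · have : dist s a ≤ c / 2 ^ (n + j) + 2 * c / 2 ^ n * (1 - 1 / 2 ^ j) :=
          (dist_triangle _ _ _).trans (add_le_add hd had)
        refine this.trans (le_of_eq ?_)
        field_simp
        ring
      · have h1 := hf (n + j) s hs s' (hmono (Nat.le_succ _) hs') (hd.trans (by gcongr; linarith))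
        have h2 : |f s - f a| ≤ R * q ^ (n + j) + R * q ^ n / (1 - q) * (1 - q ^ j) :=
          (abs_sub_le _ (f s') _).trans (add_le_add h1 haf)
        refine h2.trans (le_of_eq ?_)
        field_simp
        ring
  -- Two ancestor chains cost `1 / (1 - q)` each and the link between the ancestors costs 1; the
  -- last factor converts `q ^ n` into `dist s t ^ γ`.
  refine ⟨R * (2 / (1 - q) + 1) * (2 ^ γ / c ^ γ), fun s hs t ht hst ↦ ?_⟩
  rcases eq_or_ne s t with rfl | hne
  · simp [Real.zero_rpow hγ.ne']
  have hd0 : 0 < dist s t := dist_pos.2 hne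
  obtain ⟨n, hn1, hn2⟩ := exists_nat_pow_near_of_lt_one (x := dist s t / c) (y := (1 / 2 : ℝ))
    (by positivity) (by rw [div_le_one hc]; exact hst) (by norm_num) (by norm_num)
  rw [div_le_iff₀ hc] at hn2
  rw [lt_div_iff₀ hc] at hn1
  obtain ⟨i, hi⟩ := Set.mem_iUnion.1 hs
  obtain ⟨j, hj⟩ := Set.mem_iUnion.1 ht
  have anc' : ∀ i, ∀ s ∈ A i, ∃ a ∈ A n, dist s a ≤ 2 * c / 2 ^ n ∧
      |f s - f a| ≤ R * q ^ n / (1 - q) := by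
    intro i s hs
    obtain ⟨a, ha, h1, h2⟩ := anc n i s (hmono (Nat.le_add_left i n) hs)
    refine ⟨a, ha, h1.trans ?_, h2.trans ?_⟩
    · refine mul_le_of_le_one_right (by positivity) ?_
      have : (0 : ℝ) < 1 / 2 ^ i := by positivity
      linarith
    · refine mul_le_of_le_one_right (by positivity) ?_
      have : (0 : ℝ) < q ^ i := by positivity
      linarith
  obtain ⟨a, ha, had, haf⟩ := anc' i s hi
  obtain ⟨b, hb, hbd, hbf⟩ := anc' j t hj
  -- `5 = 2 + 1 + 2`: the two chains and `dist s t ≤ c / 2 ^ n`.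
  have hab : dist a b ≤ 5 * c / 2 ^ n := by
    have h1 : dist a b ≤ dist s a + dist s t + dist t b := by
      have := dist_triangle4 a s t b
      rwa [dist_comm a s] at this
    have h2 : (1 / 2 : ℝ) ^ n * c = c / 2 ^ n := by rw [one_div_pow]; ring
    have h3 : 2 * c / 2 ^ n = 2 * (c / 2 ^ n) := by ring
    have h4 : 5 * c / 2 ^ n = 5 * (c / 2 ^ n) := by ring
    linarith
  have habf := hf n a (hmono (Nat.le_succ n) ha) b (hmono (Nat.le_succ n) hb) hab
  have h1 : |f s - f t| ≤ R * (2 / (1 - q) + 1) * q ^ n := by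
    have h1 : |f s - f t| ≤ |f s - f a| + |f a - f b| + |f t - f b| := by
      have h2 := abs_sub_le (f s) (f a) (f t)
      have h3 := abs_sub_le (f a) (f b) (f t)
      rw [abs_sub_comm (f b)] at h3
      linarith
    have h2 : R * (2 / (1 - q) + 1) * q ^ n
        = R * q ^ n / (1 - q) + R * q ^ n + R * q ^ n / (1 - q) := by ring
    linarith
  refine h1.trans ?_
  rw [mul_assoc (R * _)]
  gcongr
  have h2 : q ^ n = ((1 / 2 : ℝ) ^ n) ^ γ := by
    rw [hq, ← Real.rpow_natCast, ← Real.rpow_mul (by norm_num), mul_comm,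
      Real.rpow_mul (by norm_num), Real.rpow_natCast]
  rw [h2, ← Real.div_rpow (by norm_num) hc.le, ← Real.mul_rpow (by positivity) dist_nonneg]
  refine Real.rpow_le_rpow (by positivity) ?_ hγ.le
  rw [div_mul_eq_mul_div, le_div_iff₀ hc]
  rw [pow_succ] at hn1
  linarith

/-! ### Hölder bounds under limits and change of exponent. -/

section Paths

variable {M : Type*} [MetricSpace M] {W : Set M} {γ K : ℝ} {f : M → ℝ}

/-- A Hölder function maps convergent sequences to convergent sequences. -/
lemma exists_tendsto_of_abs_sub_le (hγ : 0 < γ)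
    (hf : ∀ a ∈ W, ∀ b ∈ W, |f a - f b| ≤ K * dist a b ^ γ) {t : ℕ → M} {x : M}
    (ht : Filter.Tendsto t Filter.atTop (𝓝 x)) (htW : ∀ᶠ k in Filter.atTop, t k ∈ W) :
    ∃ l : ℝ, Filter.Tendsto (fun k ↦ f (t k)) Filter.atTop (𝓝 l) := by
  refine cauchySeq_tendsto_of_complete ?_
  rw [cauchySeq_iff_tendsto_dist_atTop_0]
  have h1 : Filter.Tendsto (fun n : ℕ × ℕ ↦ K * dist (t n.1) (t n.2) ^ γ) Filter.atTop (𝓝 0) := by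
    have h2 := cauchySeq_iff_tendsto_dist_atTop_0.1 ht.cauchySeq
    have h3 := (h2.rpow_const (Or.inr hγ.le)).const_mul K
    simpa [Real.zero_rpow hγ.ne'] using h3
  refine squeeze_zero' (Filter.Eventually.of_forall fun _ ↦ dist_nonneg) ?_ h1
  rw [← Filter.prod_atTop_atTop_eq]
  filter_upwards [htW.prod_mk htW] with n hn
  exact hf _ hn.1 _ hn.2

/-- Hölder bounds pass to the limit along sequences. -/
lemma abs_sub_le_of_tendsto (hγ : 0 < γ) {s t : ℕ → M} {x y : M} {a b : ℝ}
    (hs : Filter.Tendsto s Filter.atTop (𝓝 x)) (ht : Filter.Tendsto t Filter.atTop (𝓝 y))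
    (ha : Filter.Tendsto (fun k ↦ f (s k)) Filter.atTop (𝓝 a))
    (hb : Filter.Tendsto (fun k ↦ f (t k)) Filter.atTop (𝓝 b))
    (h : ∀ᶠ k in Filter.atTop, |f (s k) - f (t k)| ≤ K * dist (s k) (t k) ^ γ) :
    |a - b| ≤ K * dist x y ^ γ :=
  le_of_tendsto_of_tendsto (ha.sub hb).abs
    (((hs.dist ht).rpow_const (Or.inr hγ.le)).const_mul K) h

/-- A function that is Hölder continuous near `z` is so, with constant one, for smaller
exponents. -/
lemma exists_mem_nhds_abs_sub_le_of_lt {γ' : ℝ} (hγ' : 0 < γ') (hlt : γ' < γ) {z : M}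
    (hW : W ∈ 𝓝 z) (hf : ∀ a ∈ W, ∀ b ∈ W, |f a - f b| ≤ K * dist a b ^ γ) :
    ∃ V ∈ 𝓝 z, ∀ a ∈ V, ∀ b ∈ V, |f a - f b| ≤ 1 * dist a b ^ γ' := by
  -- The spare factor `dist ^ (γ - γ')` vanishes at the diagonal and so absorbs any constant `K`.
  have h1 : Filter.Tendsto (fun p : M × M ↦ K * dist p.1 p.2 ^ (γ - γ')) (𝓝 (z, z)) (𝓝 0) := by
    have h2 : Filter.Tendsto (fun p : M × M ↦ dist p.1 p.2) (𝓝 (z, z)) (𝓝 0) := by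
      simpa using (continuous_dist (α := M)).tendsto (z, z)
    have h3 := (h2.rpow_const (Or.inr (sub_pos.2 hlt).le)).const_mul K
    simpa [Real.zero_rpow (sub_pos.2 hlt).ne'] using h3
  have h2 := h1.eventually_lt_const (show (0 : ℝ) < 1 by norm_num)
  rw [nhds_prod_eq] at h2
  obtain ⟨V, hV, h⟩ := Filter.eventually_prod_self_iff'.1 h2
  refine ⟨W ∩ V, Filter.inter_mem hW hV, fun a ha b hb ↦ ?_⟩
  calc |f a - f b| ≤ K * dist a b ^ γ := hf a ha.1 b hb.1
    _ = (K * dist a b ^ (γ - γ')) * dist a b ^ γ' := by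
        rw [mul_assoc, ← Real.rpow_add_of_nonneg dist_nonneg (sub_pos.2 hlt).le hγ'.le,
          sub_add_cancel]
    _ ≤ 1 * dist a b ^ γ' := by
        gcongr
        exact (h _ ha.2 _ hb.2).le

end Paths

/-! ### Construction of the modification. -/

section RandomField

open scoped ENNReal

variable {M Ω : Type*} [MetricSpace M] [MeasurableSpace Ω] {P : Measure Ω} {φ : M → Ω → ℝ}
  {ρ β : ℝ}

/-- A process with Hölder continuous first moments of increments converges almost surely along
suitable sequences in a prescribed set. -/
lemma exists_seq_tendsto_ae_of_mem_closure (hφ : ∀ x, Measurable (φ x)) (hρ : 0 < ρ) (hβ : 0 < β)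
    (hmom : ∀ p : ℕ, ∃ c : ℝ≥0∞, c ≠ ⊤ ∧ ∀ x y : M, dist x y < ρ →
      ∫⁻ w, ‖φ x w - φ y w‖ₑ ^ p ∂P ≤ c * ENNReal.ofReal (dist x y ^ β) ^ p)
    {D : Set M} {x : M} (hx : x ∈ closure D) :
    ∃ t : ℕ → M, (∀ k, t k ∈ D) ∧ Filter.Tendsto t Filter.atTop (𝓝 x) ∧
      ∀ᵐ w ∂P, Filter.Tendsto (fun k ↦ φ (t k) w) Filter.atTop (𝓝 (φ x w)) := by
  obtain ⟨u, huD, hu⟩ := mem_closure_iff_seq_limit.1 hx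
  obtain ⟨c, hc, h⟩ := hmom 1
  have hd : Filter.Tendsto (fun k ↦ dist (u k) x) Filter.atTop (𝓝 0) :=
    tendsto_iff_dist_tendsto_zero.1 hu
  have hm : TendstoInMeasure P (fun k ↦ φ (u k)) Filter.atTop (φ x) := by
    refine tendstoInMeasure_of_tendsto_eLpNorm (p := 1) one_ne_zero
      (fun k ↦ (hφ _).aestronglyMeasurable) (hφ x).aestronglyMeasurable ?_
    have hlim : Filter.Tendsto (fun k ↦ c * ENNReal.ofReal (dist (u k) x ^ β)) Filter.atTop
        (𝓝 0) := by
      have h1 := hd.rpow_const (p := β) (Or.inr hβ.le)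
      rw [Real.zero_rpow hβ.ne'] at h1
      have h2 := ENNReal.Tendsto.const_mul (a := c) (ENNReal.tendsto_ofReal h1) (Or.inr hc)
      simpa using h2
    refine tendsto_of_tendsto_of_tendsto_of_le_of_le' tendsto_const_nhds hlim
      (Filter.Eventually.of_forall fun _ ↦ zero_le) ?_
    filter_upwards [hd.eventually_lt_const hρ] with k hk
    rw [eLpNorm_one_eq_lintegral_enorm]
    simpa using h _ _ hk
  obtain ⟨ns, hns, hae⟩ := hm.exists_seq_tendsto_ae
  exact ⟨u ∘ ns, fun k ↦ huD _, hu.comp hns.tendsto_atTop, hae⟩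

/-- Kolmogorov–Chentsov bound along refining nets for a process all of whose moments of increments
are Hölder continuous. -/
lemma ae_exists_abs_sub_le_of_refining_nets (hφ : ∀ x, Measurable (φ x))
    (hmom : ∀ p : ℕ, ∃ c : ℝ≥0∞, c ≠ ⊤ ∧ ∀ x y : M, dist x y < ρ →
      ∫⁻ w, ‖φ x w - φ y w‖ₑ ^ p ∂P ≤ c * ENNReal.ofReal (dist x y ^ β) ^ p)
    {A : ℕ → Finset M} {K : ℕ} {c : ℝ} (hc : 0 < c) (hcρ : 5 * c < ρ) (hmono : Monotone A)
    (hcard : ∀ n, (A n).card ≤ K ^ n)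
    (hpar : ∀ n, ∀ s ∈ A (n + 1), ∃ a ∈ A n, dist s a ≤ c / 2 ^ n)
    {γ : ℝ} (hγ : 0 < γ) (hγβ : γ < β) :
    ∀ᵐ w ∂P, ∃ R : ℝ, ∀ s ∈ ⋃ n, (A n : Set M), ∀ t ∈ ⋃ n, (A n : Set M), dist s t ≤ c →
      |φ s w - φ t w| ≤ R * dist s t ^ γ := by
  classical
  set q : ℝ := (1 / 2 : ℝ) ^ γ with hq
  set θ : ℝ := (1 / 2 : ℝ) ^ β with hθ
  have hq0 : 0 < q := by positivity
  have hθ0 : 0 < θ := by positivity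
  have hθq : θ / q < 1 := by
    rw [div_lt_one hq0]
    exact Real.rpow_lt_rpow_of_exponent_gt (by norm_num) (by norm_num) hγβ
  -- There are about `K^(2n)` pairs at level `n`, so `p` must make `K² (θ/q)^p < 1`.
  obtain ⟨p₀, hp₀⟩ := exists_pow_lt_of_lt_one
    (show (0 : ℝ) < 1 / ((K * K : ℕ) + 1) by positivity) hθq
  set p := p₀ + 1 with hp
  have hpK : ((K * K : ℕ) : ℝ) * (θ / q) ^ p < 1 := by
    have h1 : (θ / q) ^ p < 1 / ((K * K : ℕ) + 1) :=
      (pow_le_pow_of_le_one (by positivity) hθq.le (Nat.le_succ p₀)).trans_lt hp₀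
    calc ((K * K : ℕ) : ℝ) * (θ / q) ^ p ≤ ((K * K : ℕ) : ℝ) * (1 / ((K * K : ℕ) + 1)) := by gcongr
      _ < 1 := by
        rw [mul_one_div, div_lt_one (by positivity)]
        linarith
  obtain ⟨B, hB, hBm⟩ := hmom p
  let S : ℕ → Finset (M × M) := fun n ↦
    (A (n + 1) ×ˢ A (n + 1)).filter fun z ↦ dist z.1 z.2 ≤ 5 * c / 2 ^ n
  have hS : ∀ n, (S n).card ≤ (K * K) * (K * K) ^ n := by
    intro n
    refine (Finset.card_filter_le _ _).trans ?_
    rw [Finset.card_product]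
    refine (Nat.mul_le_mul (hcard _) (hcard _)).trans (le_of_eq ?_)
    ring
  have hmain := ae_exists_forall_abs_le_of_lintegral_le (P := P)
    (Z := fun (z : M × M) w ↦ φ z.1 w - φ z.2 w) (fun z ↦ (hφ _).sub (hφ _)) S (p := p)
    (Nat.succ_ne_zero _) hS (B := B * ENNReal.ofReal ((5 * c) ^ β) ^ p) (by finiteness) hθ0.le hq0
    (fun n z hz ↦ by
      have hz' := (Finset.mem_filter.1 hz).2
      have hle : 5 * c / 2 ^ n ≤ 5 * c := div_le_self (by positivity) (one_le_pow₀ (by norm_num))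
      refine (hBm _ _ ((hz'.trans hle).trans_lt hcρ)).trans ?_
      rw [mul_assoc, ← mul_pow, ← ENNReal.ofReal_mul (by positivity)]
      gcongr
      have h1 : θ ^ n = ((1 / 2 : ℝ) ^ n) ^ β := by
        rw [hθ, ← Real.rpow_natCast, ← Real.rpow_mul (by norm_num), mul_comm,
          Real.rpow_mul (by norm_num), Real.rpow_natCast]
      rw [h1, ← Real.mul_rpow (by positivity) (by positivity)]
      refine Real.rpow_le_rpow dist_nonneg (hz'.trans (le_of_eq ?_)) (hγ.trans hγβ).le
      rw [one_div_pow, mul_one_div]) hpK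
  filter_upwards [hmain] with w ⟨R, hR⟩
  refine exists_abs_sub_le_of_refining_nets hc hmono hpar hγ (R := R) fun n a ha b hb hab ↦ ?_
  exact hR n (a, b) (Finset.mem_filter.2 ⟨Finset.mem_product.2 ⟨ha, hb⟩, hab⟩)

/-- If a process is Hölder continuous on a set, almost surely, then it is also Hölder continuous on
every countable set in the closure of that set of small diameter. -/
lemma ae_exists_abs_sub_le_of_subset_closure (hφ : ∀ x, Measurable (φ x)) (hρ : 0 < ρ) (hβ : 0 < β)
    (hmom : ∀ p : ℕ, ∃ c : ℝ≥0∞, c ≠ ⊤ ∧ ∀ x y : M, dist x y < ρ →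
      ∫⁻ w, ‖φ x w - φ y w‖ₑ ^ p ∂P ≤ c * ENNReal.ofReal (dist x y ^ β) ^ p)
    {N T : Set M} {c γ : ℝ} (hγ : 0 < γ) (hT : T.Countable) (hTN : T ⊆ closure N)
    (hTc : ∀ a ∈ T, ∀ b ∈ T, dist a b < c)
    (hN : ∀ᵐ w ∂P, ∃ R : ℝ, ∀ s ∈ N, ∀ t ∈ N, dist s t ≤ c → |φ s w - φ t w| ≤ R * dist s t ^ γ) :
    ∀ᵐ w ∂P, ∃ R : ℝ, ∀ s ∈ T, ∀ t ∈ T, |φ s w - φ t w| ≤ R * dist s t ^ γ := by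
  -- `T` is countable, so one null set serves all its points; the strict bound `hTc` survives along
  -- the approximating sequences.
  have hseq := fun x (hx : x ∈ T) ↦
    exists_seq_tendsto_ae_of_mem_closure hφ hρ hβ hmom (hTN hx)
  choose u huN hu hae using hseq
  filter_upwards [hN, (ae_ball_iff hT).2 hae] with w ⟨R, hR⟩ hw
  refine ⟨R, fun a ha b hb ↦ ?_⟩
  refine abs_sub_le_of_tendsto (f := fun x ↦ φ x w) hγ (hu a ha) (hu b hb) (hw a ha) (hw b hb) ?_
  filter_upwards [((hu a ha).dist (hu b hb)).eventually_lt_const (hTc a ha b hb)] with k hk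
  exact hR _ (huN a ha k) _ (huN b hb k) hk.le

/-- A process that is almost surely locally Hölder continuous, for a sequence of exponents, on a
countable dense set, and is a limit along sequences in that set, has a modification all of whose
paths are locally Hölder continuous. -/
lemma exists_modification_of_ae_abs_sub_le (hφ : ∀ x, Measurable (φ x)) {D : Set M}
    (hseq : ∀ x : M, ∃ t : ℕ → M, (∀ k, t k ∈ D) ∧ Filter.Tendsto t Filter.atTop (𝓝 x) ∧
      ∀ᵐ w ∂P, Filter.Tendsto (fun k ↦ φ (t k) w) Filter.atTop (𝓝 (φ x w)))
    {S : Set M} {U : M → Set M} (hUo : ∀ x ∈ S, IsOpen (U x)) (hU : ∀ y, ∃ x ∈ S, y ∈ U x)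
    {g : ℕ → ℝ} (hg : ∀ n, 0 < g n) (hgβ : ∀ γ < β, ∃ n, γ < g n)
    (hae : ∀ᵐ w ∂P, ∀ x ∈ S, ∀ n, ∃ R : ℝ, ∀ a ∈ D ∩ U x, ∀ b ∈ D ∩ U x,
      |φ a w - φ b w| ≤ R * dist a b ^ g n) :
    ∃ ψ : M → Ω → ℝ, IsModificationOf P ψ φ ∧
      ∀ γ : ℝ, 0 < γ → γ < β → IsLocallyHolderField γ ψ := by
  classical
  obtain ⟨G, hGae, hGm, hG⟩ := hae.exists_measurable_mem
  choose t htD ht htae using hseq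
  have htU : ∀ x ∈ S, ∀ y ∈ U x, ∀ᶠ k in Filter.atTop, t y k ∈ D ∩ U x := fun x hx y hy ↦
    ((ht y).eventually ((hUo x hx).mem_nhds hy)).mono fun k hk ↦ ⟨htD y k, hk⟩
  have hconv : ∀ w ∈ G, ∀ y, ∃ l : ℝ,
      Filter.Tendsto (fun k ↦ φ (t y k) w) Filter.atTop (𝓝 l) := by
    intro w hw y
    obtain ⟨x, hx, hyx⟩ := hU y
    obtain ⟨R, hR⟩ := hG w hw x hx 0
    exact exists_tendsto_of_abs_sub_le (f := fun z ↦ φ z w) (hg 0) hR (ht y) (htU x hx y hyx)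
  -- The value 0 off `G` makes every path Hölder, not only almost every one.
  let ψ : M → Ω → ℝ := fun y w ↦
    if w ∈ G then Filter.limUnder Filter.atTop (fun k ↦ φ (t y k) w) else 0
  have hψ : ∀ w ∈ G, ∀ y, Filter.Tendsto (fun k ↦ φ (t y k) w) Filter.atTop (𝓝 (ψ y w)) := by
    intro w hw y
    simp only [ψ, if_pos hw]
    exact tendsto_nhds_limUnder (hconv w hw y)
  have hψ' : ∀ w ∉ G, ∀ y, ψ y w = 0 := fun w hw y ↦ if_neg hw
  refine ⟨ψ, ⟨fun y ↦ ?_, fun y ↦ ?_⟩, fun γ hγ hγβ x₀ ↦ ?_⟩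
  · refine measurable_of_tendsto_metrizable
      (f := fun k ↦ G.indicator (φ (t y k))) (fun k ↦ (hφ _).indicator hGm) ?_
    rw [tendsto_pi_nhds]
    intro w
    by_cases hw : w ∈ G
    · simpa [Set.indicator_of_mem hw] using hψ w hw y
    · simp [Set.indicator_of_notMem hw, hψ' w hw y]
  · filter_upwards [hGae, htae y] with w hw hlim
    exact tendsto_nhds_unique (hψ w hw y) hlim
  · refine ⟨Set.univ, Filter.univ_mem, 1, fun w z _ ↦ ?_⟩
    by_cases hw : w ∈ G
    · obtain ⟨n, hn⟩ := hgβ γ hγβ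
      obtain ⟨x, hx, hzx⟩ := hU z
      obtain ⟨R, hR⟩ := hG w hw x hx n
      refine exists_mem_nhds_abs_sub_le_of_lt (f := fun y ↦ ψ y w) (K := R) hγ hn
        ((hUo x hx).mem_nhds hzx) fun a ha b hb ↦ ?_
      refine abs_sub_le_of_tendsto (f := fun y ↦ φ y w) (hg n) (ht a) (ht b) (hψ w hw a)
        (hψ w hw b) ?_
      filter_upwards [htU x hx a ha, htU x hx b hb] with k h1 h2
      exact hR _ h1 _ h2
    · refine ⟨Set.univ, Filter.univ_mem, fun x _ y _ ↦ ?_⟩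
      rw [hψ' w hw x, hψ' w hw y, sub_self, abs_zero]
      positivity

/-- Kolmogorov–Chentsov theorem on a connected metric space with local refining nets of exponential
growth, for processes all of whose moments of increments are Hölder continuous. -/
theorem exists_modification_isLocallyHolderField [ConnectedSpace M]
    (hφ : ∀ x, Measurable (φ x)) (hρ : 0 < ρ) (hβ : 0 < β)
    (hmom : ∀ p : ℕ, ∃ c : ℝ≥0∞, c ≠ ⊤ ∧ ∀ x y : M, dist x y < ρ →
      ∫⁻ w, ‖φ x w - φ y w‖ₑ ^ p ∂P ≤ c * ENNReal.ofReal (dist x y ^ β) ^ p)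
    (hnets : ∀ (x₀ : M) {δ : ℝ}, 0 < δ →
      ∃ (A : ℕ → Finset M) (K : ℕ) (c : ℝ), 0 < c ∧ c ≤ δ ∧ Monotone A ∧
        (∀ n, (A n).card ≤ K ^ n) ∧
        (∀ n, ∀ s ∈ A (n + 1), ∃ a ∈ A n, dist s a ≤ c / 2 ^ n) ∧
        closure (⋃ n, (A n : Set M)) ∈ 𝓝 x₀) :
    ∃ ψ : M → Ω → ℝ, IsModificationOf P ψ φ ∧
      ∀ γ : ℝ, 0 < γ → γ < β → IsLocallyHolderField γ ψ := by
  -- With `c ≤ ρ / 10`, pairs at distance `5 * c` stay within the range of `hmom`.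
  have hnets' := fun x₀ : M ↦ hnets x₀ (show 0 < ρ / 10 by positivity)
  choose A K c hc hcρ hmono hcard hpar hnhds using hnets'
  let N : M → Set M := fun x ↦ ⋃ n, (A x n : Set M)
  have hNc : ∀ x, (N x).Countable := fun x ↦ Set.countable_iUnion fun n ↦ (A x n).countable_toSet
  obtain ⟨D, hD, hDd⟩ := exists_countable_dense_of_connected fun x ↦ ⟨N x, hNc x, hnhds x⟩
  have : TopologicalSpace.SeparableSpace M := ⟨D, hD, hDd⟩
  have : SecondCountableTopology M := UniformSpace.secondCountable_of_separable M
  -- Radius `c x / 2` keeps any two points of `U x` closer than `c x`.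
  let U : M → Set M := fun x ↦ interior (closure (N x)) ∩ Metric.ball x (c x / 2)
  have hUo : ∀ x, IsOpen (U x) := fun x ↦ isOpen_interior.inter Metric.isOpen_ball
  have hUx : ∀ x, U x ∈ 𝓝 x := fun x ↦
    Filter.inter_mem (interior_mem_nhds.2 (hnhds x)) (Metric.ball_mem_nhds _ (half_pos (hc x)))
  obtain ⟨S, hS, hSU⟩ := TopologicalSpace.countable_cover_nhds hUx
  -- Exponents tending to `β` from below; the shift by one makes `g 0 = β / 2` positive.
  let g : ℕ → ℝ := fun n ↦ β * (1 - 1 / ((n + 1 : ℕ) + 1))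
  have hg : ∀ n, 0 < g n ∧ g n < β := by
    intro n
    have h1 : (0 : ℝ) < 1 / ((n + 1 : ℕ) + 1) := by positivity
    have h2 : (1 : ℝ) / ((n + 1 : ℕ) + 1) < 1 := by
      rw [div_lt_one (by positivity)]
      push_cast
      linarith [(Nat.cast_nonneg n : (0 : ℝ) ≤ n)]
    exact ⟨mul_pos hβ (by linarith), mul_lt_of_lt_one_right hβ (by linarith)⟩
  have hgβ : ∀ γ < β, ∃ n, γ < g n := by
    intro γ hγ
    have h1 : Filter.Tendsto g Filter.atTop (𝓝 (β * (1 - 0))) :=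
      (((tendsto_one_div_add_atTop_nhds_zero_nat (𝕜 := ℝ)).comp
        (Filter.tendsto_add_atTop_nat 1)).const_sub 1).const_mul β
    rw [sub_zero, mul_one] at h1
    exact (h1.eventually_const_lt hγ).exists
  refine exists_modification_of_ae_abs_sub_le hφ (D := D) (S := S) (U := U)
    (fun x ↦ exists_seq_tendsto_ae_of_mem_closure hφ hρ hβ hmom (hDd x)) (fun x _ ↦ hUo x)
    (fun y ↦ ?_) (fun n ↦ (hg n).1) hgβ ?_
  · have : y ∈ ⋃ x ∈ S, U x := hSU ▸ Set.mem_univ y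
    simpa using this
  · rw [ae_ball_iff hS]
    intro x _
    rw [ae_all_iff]
    intro n
    refine ae_exists_abs_sub_le_of_subset_closure hφ hρ hβ hmom (N := N x) (c := c x) (hg n).1
      (hD.mono Set.inter_subset_left) (fun y hy ↦ interior_subset hy.2.1) (fun a ha b hb ↦ ?_)
      (ae_exists_abs_sub_le_of_refining_nets hφ hmom (hc x) (by linarith [hcρ x]) (hmono x)
        (hcard x) (hpar x) (hg n).1 (hg n).2)
    have h1 := Metric.mem_ball.1 ha.2.2
    have h2 := Metric.mem_ball'.1 hb.2.2
    linarith [dist_triangle a x b]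

end RandomField

/-! ### Application to Riemannian manifolds. -/

/-- A smooth Riemannian metric is continuous. -/
lemma IsContMDiffRiemannianBundle.isContinuousRiemannianBundle
    {EB : Type*} [NormedAddCommGroup EB] [NormedSpace ℝ EB]
    {HB : Type*} [TopologicalSpace HB] {IB : ModelWithCorners ℝ EB HB} {n : ℕ∞ω}
    {B : Type*} [TopologicalSpace B] [ChartedSpace HB B]
    {F : Type*} [NormedAddCommGroup F] [NormedSpace ℝ F]
    {E : B → Type*} [TopologicalSpace (Bundle.TotalSpace F E)] [∀ x, NormedAddCommGroup (E x)]
    [∀ x, InnerProductSpace ℝ (E x)] [FiberBundle F E] [VectorBundle ℝ F E]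
    [h : IsContMDiffRiemannianBundle IB n F E] : IsContinuousRiemannianBundle F E := by
  obtain ⟨g, hg, hi⟩ := h.exists_contMDiff
  exact ⟨g, hg.continuous, hi⟩

theorem mainTheorem4 (m : ℕ)
    {M : Type*} [MetricSpace M] [ConnectedSpace M]
    [ChartedSpace (EuclideanSpace ℝ (Fin m)) M] [IsManifold (𝓡 m) ∞ M]
    [Bundle.RiemannianBundle (fun (x : M) ↦ TangentSpace (𝓡 m) x)]
    [IsContMDiffRiemannianBundle (𝓡 m) ∞ (EuclideanSpace ℝ (Fin m))
      (fun (x : M) ↦ TangentSpace (𝓡 m) x)]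
    [IsRiemannianManifold (𝓡 m) M]
    {Ω : Type*} [MeasurableSpace Ω] (P : Measure Ω) [IsProbabilityMeasure P]
    (φ : M → Ω → ℝ) (hφ_meas : ∀ x, Measurable (φ x)) (hφ : IsGaussianProcess φ P)
    (ρ η C : ℝ) (hρ_pos : 0 < ρ) (hρ_le : ρ ≤ 1) (hη_pos : 0 < η) (hη_lt : η < 1) (hC : 0 < C)
    (hvar : ∀ x y : M, dist x y < ρ → variogram P φ x y ≤ C * dist x y ^ η) :
    ∃ ψ : M → Ω → ℝ, IsModificationOf P ψ φ ∧
      ∀ γ : ℝ, 0 < γ → γ < η / 2 → IsLocallyHolderField γ ψ := by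
  have : IsContinuousRiemannianBundle (EuclideanSpace ℝ (Fin m))
      (fun (x : M) ↦ TangentSpace (𝓡 m) x) :=
    IsContMDiffRiemannianBundle.isContinuousRiemannianBundle (IB := 𝓡 m) (n := ∞)
  have : IsManifold (𝓡 m) 1 M := IsManifold.of_le (n := ∞) (by simp)
  exact exists_modification_isLocallyHolderField hφ_meas hρ_pos (half_pos hη_pos)
    (IsGaussianProcess.exists_lintegral_enorm_sub_pow_le hφ hC.le hvar)
    (fun x₀ _ hδ ↦ exists_refining_nets (E := EuclideanSpace ℝ (Fin m)) x₀ hδ)
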